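/- **Theorem 3.** Let $\sigma_0=I,\sigma_x,\sigma_y,\sigma_z$ be the Pauli matrices. A *Pauli operator* on $n$ qubits is $\sigma=\sigma_{i_1}\otimes\dots\otimes\sigma_{i_n}$ with $i_1,\dots,i_n\in\{0,x,y,z\}$; its *weight* is the number of $k$ with $i_k\neq 0$. A *$d$-body Hamiltonian* on $n$ qubits is an operator $H=\sum_\sigma h_\sigma\sigma$, where $\sigma$ runs over the Pauli operators of weight at most $d$ and the $h_\sigma$ are real. A *non-degenerate ground state* of a Hamiltonian $H$ is an eigenvector for the smallest eigenvalue of $H$, when the eigenspace of that eigenvalue is one-dimensional. Let $G$ be a simple graph with vertex set $V=\{1,\dots,n\}$, and let the graph state $|G\rangle$ be the unit vector of $(\mathbb C^2)^{\otimes n}$ (unique up to a phase) that is fixed by the operators $\sigma_x^{(a)}\prod_{b\in N(a)}\sigma_z^{(b)}$ for all $a\in V$, where $N(a)$ is the set of neighbours of $a$ and the superscript denotes the qubit on which a Pauli matrix acts. Let $\mathcal S$, the stabilizer, be the group of all operators $g=\pm\sigma$, with $\sigma$ a Pauli operator, such that $g|G\rangle=|G\rangle$; the weight of $g$ is that of $\sigma$.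 For $d\ge 0$ let $\mathcal S_d$ be the subgroup generated by the elements of $\mathcal S$ of weight at most $d$, and let $\eta(|G\rangle)$ be the least $d$ with $\mathcal S_d=\mathcal S$. Then: (i) there is an $\eta(|G\rangle)$-body Hamiltonian on $n$ qubits that has $|G\rangle$ as a non-degenerate ground state; (ii) every $n$-qubit Hamiltonian that has $|G\rangle$ as a non-degenerate ground state involves at least $\eta(|G\rangle)$-body interactions: if a $d$-body Hamiltonian on $n$ qubits has $|G\rangle$ as a non-degenerate ground state, then $d\ge\eta(|G\rangle)$; (iii) if $G$ is connected and $n\ge 3$, then $\eta(|G\rangle)\ge 3$; in particular, no two-body Hamiltonian on $n$ qubits has $|G\rangle$ as a non-degenerate ground state. -/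

import Mathlib

open scoped Matrix

/-- Labels of the four single-qubit Pauli matrices `σ₀ = I`, `σ_x`, `σ_y`, `σ_z`. -/
inductive PauliLabel where
  | I | X | Y | Z
  deriving DecidableEq

instance : Fintype PauliLabel where
  elems := {.I, .X, .Y, .Z}
  complete := by intro p; cases p <;> simp

/-- The `2 × 2` matrix of a Pauli label. -/
noncomputable def PauliLabel.toMatrix : PauliLabel → Matrix (Fin 2) (Fin 2) ℂ
  | .I => 1
  | .X => !![0, 1; 1, 0]
  | .Y => !![0, -Complex.I; Complex.I, 0]
  | .Z => !![1, 0; 0, -1]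

/-- Computational basis labels of `n` qubits. -/
abbrev Bits (n : ℕ) : Type := Fin n → Fin 2

/-- Vectors of the `n`-qubit space `(ℂ²)^{⊗ n}`, in the computational basis. -/
abbrev QVec (n : ℕ) : Type := Bits n → ℂ

/-- Operators on the `n`-qubit space, in the computational basis. -/
abbrev QOp (n : ℕ) : Type := Matrix (Bits n) (Bits n) ℂ

/-- A choice of a Pauli matrix for each of the `n` qubits. -/
abbrev PauliString (n : ℕ) : Type := Fin n → PauliLabel

/-- The Pauli operator `σ_{p 1} ⊗ ⋯ ⊗ σ_{p n}`. -/
noncomputable def pauliOp {n : ℕ} (p : PauliString n) : QOp n :=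
  fun x y => ∏ i, (p i).toMatrix (x i) (y i)

/-- The weight of a Pauli operator: the number of qubits on which it acts nontrivially. -/
def weight {n : ℕ} (p : PauliString n) : ℕ :=
  (Finset.univ.filter (fun i => p i ≠ PauliLabel.I)).card

/-- `H` is a `d`-body Hamiltonian on `n` qubits: a real linear combination of the Pauli operators
of weight at most `d`. -/
def IsBodyHamiltonian {n : ℕ} (d : ℕ) (H : QOp n) : Prop :=
  ∃ h : PauliString n → ℝ,
    H = ∑ p ∈ Finset.univ.filter (fun p : PauliString n => weight p ≤ d), (h p : ℂ) • pauliOp p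

/-- `ψ` is a non-degenerate ground state of `H`: it is an eigenvector of the Hermitian operator
`H` for its smallest eigenvalue `E`, and the eigenspace of `E` is one-dimensional. -/
def IsNondegenerateGroundState {n : ℕ} (H : QOp n) (ψ : QVec n) : Prop :=
  H.IsHermitian ∧ ∃ E : ℝ,
    Module.End.HasEigenvector (Matrix.toLin' H) (E : ℂ) ψ ∧
    (∀ μ : ℝ, Module.End.HasEigenvalue (Matrix.toLin' H) (μ : ℂ) → E ≤ μ) ∧
    Module.finrank ℂ (Module.End.eigenspace (Matrix.toLin' H) (E : ℂ)) = 1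

open Classical in
/-- The Pauli string of the operator `σ_x^{(a)} ∏_{b ∈ N(a)} σ_z^{(b)}`. -/
noncomputable def graphGenerator {n : ℕ} (G : SimpleGraph (Fin n)) (a : Fin n) : PauliString n :=
  fun b => if b = a then PauliLabel.X else if G.Adj a b then PauliLabel.Z else PauliLabel.I

/-- `ψ` is the graph state `|G⟩` (which is determined up to a global phase): a unit vector fixed by
all the operators `σ_x^{(a)} ∏_{b ∈ N(a)} σ_z^{(b)}`. -/
def IsGraphState {n : ℕ} (G : SimpleGraph (Fin n)) (ψ : QVec n) : Prop :=
  ∑ x, ‖ψ x‖ ^ 2 = 1 ∧ ∀ a, pauliOp (graphGenerator G a) *ᵥ ψ = ψ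

/-- The elements of weight at most `d` of the stabilizer of `ψ`: the operators `g = ± σ`, with `σ` a
Pauli operator of weight at most `d`, such that `g ψ = ψ`. -/
def stabilizerUpTo {n : ℕ} (ψ : QVec n) (d : ℕ) : Set (QOp n)ˣ :=
  {g | (∃ p : PauliString n, weight p ≤ d ∧
      ((g : QOp n) = pauliOp p ∨ (g : QOp n) = -pauliOp p)) ∧ (g : QOp n) *ᵥ ψ = ψ}

/-- The stabilizer `S` of `ψ`: all operators `g = ± σ`, with `σ` a Pauli operator, such that
`g ψ = ψ`. For `ψ ≠ 0` this is a group. -/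
def stabilizer {n : ℕ} (ψ : QVec n) : Set (QOp n)ˣ :=
  {g | (∃ p : PauliString n, (g : QOp n) = pauliOp p ∨ (g : QOp n) = -pauliOp p) ∧
    (g : QOp n) *ᵥ ψ = ψ}

/-- The subgroup `S_d` generated by the stabilizer elements of weight at most `d`. -/
def stabilizerSubgroup {n : ℕ} (ψ : QVec n) (d : ℕ) : Subgroup (QOp n)ˣ :=
  Subgroup.closure (stabilizerUpTo ψ d)

/-- `η`: the least `d` with `S_d = S`. -/
noncomputable def eta {n : ℕ} (ψ : QVec n) : ℕ :=
  sInf {d : ℕ | (stabilizerSubgroup ψ d : Set (QOp n)ˣ) = stabilizer ψ}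

/-- The graph state exists: its amplitude at `x` is `2^{-n/2} (-1)^{e(x)}`, where `e(x)` is the
number of edges `{i, j}` with `x i = x j = 1`. -/
theorem exists_isGraphState {n : ℕ} (G : SimpleGraph (Fin n)) : ∃ ψ : QVec n, IsGraphState G ψ := by
  classical
  set c : Bits n → Fin n → Fin n → ℂ := fun x i j =>
    if i < j ∧ G.Adj i j ∧ x i = 1 ∧ x j = 1 then -1 else 1 with hc
  have hcc : ∀ x i j, c x i j * c x i j = 1 := by
    intro x i j; simp only [hc]; split_ifs <;> norm_num
  set s : Bits n → ℂ := fun x => ∏ i, ∏ j, c x i j with hs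
  have hss : ∀ x, s x * s x = 1 := by
    intro x
    simp only [hs, ← Finset.prod_mul_distrib, hcc, Finset.prod_const_one]
  have hsn : ∀ x, ‖s x‖ = 1 := by
    intro x
    have h := congrArg norm (hss x)
    rw [norm_mul, norm_one] at h
    nlinarith [norm_nonneg (s x)]
  have h2 : (0 : ℝ) < 2 ^ n := by positivity
  refine ⟨fun x => ((Real.sqrt (2 ^ n))⁻¹ : ℝ) * s x, ?_, ?_⟩
  · simp only [norm_mul, hsn, mul_one, Complex.norm_real, Real.norm_eq_abs, sq_abs, inv_pow,
      Real.sq_sqrt h2.le, Finset.sum_const, Finset.card_univ, Fintype.card_pi, Fintype.card_fin,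
      Finset.prod_const, nsmul_eq_mul]
    push_cast
    field_simp
  · intro a
    set f : Bits n → Bits n := fun x => Function.update x a (1 - x a) with hf
    set w : Bits n → ℂ := fun x => ∏ b, if G.Adj a b ∧ x b = 1 then -1 else 1 with hw
    have hop : ∀ x y, pauliOp (graphGenerator G a) x y = if y = f x then w x else 0 := by
      intro x y
      by_cases hy : y = f x
      · subst hy
        simp only [if_true, pauliOp, hw]
        refine Finset.prod_congr rfl fun b _ => ?_
        by_cases hb : b = a
        · subst hb
          have : x b = 0 ∨ x b = 1 := by omega
          rcases this with h | h <;> simp [graphGenerator, hf, PauliLabel.toMatrix, h]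
        · by_cases hA : G.Adj a b
          · have : x b = 0 ∨ x b = 1 := by omega
            rcases this with h | h <;>
              simp [graphGenerator, hf, PauliLabel.toMatrix, h, hb, hA]
          · have h1 : f x b = x b := by simp [hf, hb]
            rw [h1]
            simp [graphGenerator, PauliLabel.toMatrix, hb, hA]
      · rw [if_neg hy]
        obtain ⟨b, hb⟩ := Function.ne_iff.1 hy
        refine Finset.prod_eq_zero (Finset.mem_univ b) ?_
        by_cases hba : b = a
        · subst hba
          have h1 : x b = 0 ∨ x b = 1 := by omega
          have h2 : y b = 0 ∨ y b = 1 := by omega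
          rcases h1 with h1 | h1 <;> rcases h2 with h2 | h2 <;>
            simp [hf, h1, h2] at hb <;> simp [graphGenerator, PauliLabel.toMatrix, h1, h2]
        · simp only [hf, Function.update_of_ne hba] at hb
          have h1 : x b = 0 ∨ x b = 1 := by omega
          have h2 : y b = 0 ∨ y b = 1 := by omega
          by_cases hA : G.Adj a b <;> rcases h1 with h1 | h1 <;> rcases h2 with h2 | h2 <;>
            simp [h1, h2] at hb <;> simp [graphGenerator, PauliLabel.toMatrix, h1, h2, hA, hba]
    have hflip : ∀ x, s x * s (f x) = w x := by
      intro x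
      have key : ∀ i j, c x i j * c (f x) i j =
          (if i = a then (if a < j ∧ G.Adj a j ∧ x j = 1 then -1 else 1) else 1) *
          (if j = a then (if i < a ∧ G.Adj a i ∧ x i = 1 then -1 else 1) else 1) := by
        intro i j
        by_cases hi : i = a
        · subst hi
          by_cases hj : j = i
          · subst hj; simp [hc]
          · have h1 : x i = 0 ∨ x i = 1 := by omega
            rcases h1 with h1 | h1 <;> simp [hc, hf, hj, h1]
        · by_cases hj : j = a
          · subst hj
            have h1 : x j = 0 ∨ x j = 1 := by omega
            rcases h1 with h1 | h1 <;> simp [hc, hf, hi, h1, G.adj_comm j i]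
          · simp only [hi, hj, if_false, mul_one]
            simp only [hc, hf, Function.update_of_ne hi, Function.update_of_ne hj]
            split_ifs <;> norm_num
      have : s x * s (f x) = ∏ i, ∏ j, c x i j * c (f x) i j := by
        simp only [hs, Finset.prod_mul_distrib]
      rw [this]
      simp only [key, Finset.prod_mul_distrib]
      rw [Finset.prod_comm]
      simp only [Finset.prod_ite_eq', Finset.mem_univ, if_true]
      simp only [hw, ← Finset.prod_mul_distrib]
      refine Finset.prod_congr rfl fun b _ => ?_
      rcases lt_trichotomy a b with h | h | h
      · simp [h, not_lt_of_gt h]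
      · subst h; simp
      · simp [h, not_lt_of_gt h]
    funext x
    simp only [Matrix.mulVec, dotProduct, hop, ite_mul, zero_mul, Finset.sum_ite_eq',
      Finset.mem_univ, if_true]
    rw [← hflip x]
    linear_combination ((Real.sqrt (2 ^ n))⁻¹ : ℝ) * s x * hss (f x)

/-! Everything rests on commutation of Pauli operators. Two of them commute or anticommute, so a
Pauli operator `σ` either commutes with all graph generators, and then `σψ = ±ψ` because their
common fixed space is the line through `ψ`, or anticommutes with one, and then its expectation in
`ψ` is zero.

Upper bound: sum `1 - g` over the stabilizer elements `g` of weight at most `η`. Each term is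
positive semidefinite and kills `ψ`. A vector killed by the sum is killed by each term, hence fixed
by `S_η = S`, in particular by the graph generators, hence a multiple of `ψ`.

Lower bound: let `P` be the sum over `S_d`. Its trace is `2^n`, and `P / 2^n` has the same
expectations as `ψ` for all Pauli operators of weight at most `d`, so the same energy `E` for a
`d`-body `H`. As `H - E` is positive semidefinite, `(H - E) P = 0`, and non-degeneracy puts the
range of `P` inside the line of `ψ`. Then `s P = P` for every `s ∈ S`; but if `s ∉ S_d`, the coset
`s S_d` misses the identity and `s P` has trace zero.

Connected graphs: the operator with `Z` on every vertex of degree at least two commutes with all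
stabilizer elements of weight at most two, yet anticommutes with the generator at such a vertex. So
`S_2` is not `S`. -/

/-! ### Tensor products and the Pauli algebra. -/

section TensorProduct

variable {n : ℕ}

/-- The tensor product of single-qubit matrices. -/
def tensorOp (M : Fin n → Matrix (Fin 2) (Fin 2) ℂ) : QOp n :=
  fun x y => ∏ i, M i (x i) (y i)

lemma pauliOp_eq_tensorOp (p : PauliString n) : pauliOp p = tensorOp fun i => (p i).toMatrix := rfl

lemma tensorOp_mul (M N : Fin n → Matrix (Fin 2) (Fin 2) ℂ) :
    tensorOp M * tensorOp N = tensorOp fun i => M i * N i := by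
  ext x y
  simp only [tensorOp, Matrix.mul_apply, ← Finset.prod_mul_distrib]
  rw [Finset.prod_univ_sum, Fintype.piFinset_univ]

lemma tensorOp_smul (c : Fin n → ℂ) (M : Fin n → Matrix (Fin 2) (Fin 2) ℂ) :
    tensorOp (fun i => c i • M i) = (∏ i, c i) • tensorOp M := by
  ext x y
  simp [tensorOp, Finset.prod_mul_distrib]

lemma tensorOp_one : tensorOp (fun _ : Fin n => 1) = 1 := by
  ext x y
  simp only [tensorOp, Matrix.one_apply]
  by_cases h : x = y
  · simp [h]
  · rw [if_neg h]
    obtain ⟨i, hi⟩ := Function.ne_iff.1 h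
    exact Finset.prod_eq_zero (Finset.mem_univ i) (if_neg hi)

lemma tensorOp_conjTranspose (M : Fin n → Matrix (Fin 2) (Fin 2) ℂ) :
    (tensorOp M)ᴴ = tensorOp fun i => (M i)ᴴ := by
  ext x y
  simp [tensorOp, Matrix.conjTranspose_apply]

lemma trace_tensorOp (M : Fin n → Matrix (Fin 2) (Fin 2) ℂ) :
    (tensorOp M).trace = ∏ i, (M i).trace := by
  simp only [tensorOp, Matrix.trace, Matrix.diag]
  rw [Finset.prod_univ_sum, Fintype.piFinset_univ]

end TensorProduct

namespace PauliLabel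

/-- The product of two Pauli labels, up to a phase. -/
def mulLabel : PauliLabel → PauliLabel → PauliLabel
  | I, q => q
  | p, I => p
  | X, X => I
  | X, Y => Z
  | X, Z => Y
  | Y, X => Z
  | Y, Y => I
  | Y, Z => X
  | Z, X => Y
  | Z, Y => X
  | Z, Z => I

/-- The sign `1` or `-1` according to whether two Pauli matrices commute or anticommute. -/
def commSign (p q : PauliLabel) : ℤ :=
  if p = I ∨ q = I ∨ p = q then 1 else -1

lemma conjTranspose_toMatrix (p : PauliLabel) : p.toMatrixᴴ = p.toMatrix := by
  cases p <;> ext i j <;> fin_cases i <;> fin_cases j <;> simp [toMatrix]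

lemma toMatrix_mul_self (p : PauliLabel) : p.toMatrix * p.toMatrix = 1 := by
  cases p <;> ext i j <;> fin_cases i <;> fin_cases j <;> simp [toMatrix]

lemma exists_toMatrix_mul (p q : PauliLabel) :
    ∃ c : ℂ, p.toMatrix * q.toMatrix = c • (p.mulLabel q).toMatrix := by
  cases p <;> cases q
  case X.Y => exact ⟨Complex.I, by ext i j; fin_cases i <;> fin_cases j <;> simp [toMatrix, mulLabel]⟩
  case X.Z => exact ⟨-Complex.I, by ext i j; fin_cases i <;> fin_cases j <;> simp [toMatrix, mulLabel]⟩
  case Y.X => exact ⟨-Complex.I, by ext i j; fin_cases i <;> fin_cases j <;> simp [toMatrix, mulLabel]⟩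
  case Y.Z => exact ⟨Complex.I, by ext i j; fin_cases i <;> fin_cases j <;> simp [toMatrix, mulLabel]⟩
  case Z.X => exact ⟨Complex.I, by ext i j; fin_cases i <;> fin_cases j <;> simp [toMatrix, mulLabel]⟩
  case Z.Y => exact ⟨-Complex.I, by ext i j; fin_cases i <;> fin_cases j <;> simp [toMatrix, mulLabel]⟩
  all_goals exact ⟨1, by ext i j; fin_cases i <;> fin_cases j <;> simp [toMatrix, mulLabel]⟩

lemma toMatrix_mul_comm (p q : PauliLabel) :
    p.toMatrix * q.toMatrix = (commSign p q : ℂ) • (q.toMatrix * p.toMatrix) := by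
  cases p <;> cases q <;> ext i j <;> fin_cases i <;> fin_cases j <;>
    simp [toMatrix, commSign]

lemma trace_toMatrix_mul {p q : PauliLabel} (h : p ≠ q) :
    (p.toMatrix * q.toMatrix).trace = 0 := by
  cases p <;> cases q <;> first | exact absurd rfl h | simp [toMatrix, Matrix.trace_fin_two]

lemma commSign_eq_or (p q : PauliLabel) : commSign p q = 1 ∨ commSign p q = -1 := by
  unfold commSign; split_ifs <;> simp

end PauliLabel

section PauliOperators

variable {n : ℕ}

/-- The sign `1` or `-1` according to whether two Pauli operators commute or anticommute. -/
def commSign (p q : PauliString n) : ℤ := ∏ i, (p i).commSign (q i)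

lemma commSign_eq_or (p q : PauliString n) : commSign p q = 1 ∨ commSign p q = -1 := by
  unfold commSign
  induction (Finset.univ : Finset (Fin n)) using Finset.cons_induction with
  | empty => simp
  | cons a s ha ih =>
    rw [Finset.prod_cons]
    rcases ih with h | h <;> rcases (p a).commSign_eq_or (q a) with h' | h' <;> simp [h, h']

lemma pauliOp_conjTranspose (p : PauliString n) : (pauliOp p)ᴴ = pauliOp p := by
  simp only [pauliOp_eq_tensorOp, tensorOp_conjTranspose, PauliLabel.conjTranspose_toMatrix]

lemma pauliOp_mul_self (p : PauliString n) : pauliOp p * pauliOp p = 1 := by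
  simp only [pauliOp_eq_tensorOp, tensorOp_mul, PauliLabel.toMatrix_mul_self, tensorOp_one]

lemma pauliOp_I : pauliOp (fun _ : Fin n => PauliLabel.I) = 1 := by
  simp only [pauliOp_eq_tensorOp, PauliLabel.toMatrix, tensorOp_one]

/-- The phase can stay unspecified: a fixed nonzero vector later forces it to be `1` or `-1`. -/
lemma exists_pauliOp_mul (p q : PauliString n) :
    ∃ (c : ℂ) (r : PauliString n), pauliOp p * pauliOp q = c • pauliOp r := by
  choose c hc using fun i => PauliLabel.exists_toMatrix_mul (p i) (q i)
  refine ⟨∏ i, c i, fun i => (p i).mulLabel (q i), ?_⟩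
  simp only [pauliOp_eq_tensorOp, tensorOp_mul, hc, tensorOp_smul]

lemma pauliOp_mul_comm (p q : PauliString n) :
    pauliOp p * pauliOp q = (commSign p q : ℂ) • (pauliOp q * pauliOp p) := by
  simp only [pauliOp_eq_tensorOp, tensorOp_mul, commSign, Int.cast_prod, ← tensorOp_smul,
    ← PauliLabel.toMatrix_mul_comm]

lemma trace_pauliOp_mul {p q : PauliString n} (h : p ≠ q) :
    (pauliOp p * pauliOp q).trace = 0 := by
  obtain ⟨i, hi⟩ := Function.ne_iff.1 h
  simp only [pauliOp_eq_tensorOp, tensorOp_mul, trace_tensorOp]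
  exact Finset.prod_eq_zero (Finset.mem_univ i) (PauliLabel.trace_toMatrix_mul hi)

lemma trace_pauliOp {p : PauliString n} (h : p ≠ fun _ => PauliLabel.I) :
    (pauliOp p).trace = 0 := by
  simpa [pauliOp_I] using trace_pauliOp_mul h

lemma trace_one_qOp : (1 : QOp n).trace = 2 ^ n := by
  simp [Matrix.trace_one]

lemma weight_le (p : PauliString n) : weight p ≤ n :=
  (Finset.card_filter_le _ _).trans (by simp)

/-- A Pauli operator as a unit of the operator algebra. -/
noncomputable def pauliUnit (p : PauliString n) : (QOp n)ˣ :=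
  ⟨pauliOp p, pauliOp p, pauliOp_mul_self p, pauliOp_mul_self p⟩

@[simp] lemma val_pauliUnit (p : PauliString n) : (pauliUnit p : QOp n) = pauliOp p := rfl

end PauliOperators

/-! ### The stabilizer group. -/

section Stabilizer

variable {n : ℕ} {ψ : QVec n}

/-- The stabilizer of a nonzero vector, as a group. -/
noncomputable def stabilizerGroup (ψ : QVec n) (h0 : ψ ≠ 0) : Subgroup (QOp n)ˣ where
  carrier := stabilizer ψ
  one_mem' := ⟨⟨_, Or.inl pauliOp_I.symm⟩, by simp⟩
  mul_mem' := by
    rintro g k ⟨⟨p, hp⟩, hg⟩ ⟨⟨q, hq⟩, hk⟩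
    have hfix : ((g * k : (QOp n)ˣ) : QOp n) *ᵥ ψ = ψ := by
      rw [Units.val_mul, ← Matrix.mulVec_mulVec, hk, hg]
    refine ⟨?_, hfix⟩
    obtain ⟨c, r, hr⟩ := exists_pauliOp_mul p q
    obtain ⟨c, hc⟩ : ∃ c : ℂ, ((g * k : (QOp n)ˣ) : QOp n) = c • pauliOp r := by
      rcases hp with hp | hp <;> rcases hq with hq | hq <;> rw [Units.val_mul, hp, hq]
      · exact ⟨c, hr⟩
      · exact ⟨-c, by rw [mul_neg, hr, neg_smul]⟩
      · exact ⟨-c, by rw [neg_mul, hr, neg_smul]⟩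
      · exact ⟨c, by rw [neg_mul_neg, hr]⟩
    refine ⟨r, ?_⟩
    -- Applying the product twice squares the phase, since a Pauli operator is an involution.
    have h2 : (c * c) • ψ = ψ := by
      conv_rhs => rw [← hfix, ← hfix, Matrix.mulVec_mulVec, hc]
      rw [smul_mul_smul_comm, pauliOp_mul_self, Matrix.smul_mulVec, Matrix.one_mulVec]
    have hcc : c * c = 1 := by
      have : (c * c - 1) • ψ = 0 := by rw [sub_smul, h2, one_smul, sub_self]
      exact sub_eq_zero.1 ((smul_eq_zero.1 this).resolve_right h0)
    rcases mul_self_eq_one_iff.1 hcc with h | h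
    · left; rw [hc, h, one_smul]
    · right; rw [hc, h, neg_one_smul]
  inv_mem' := by
    rintro g ⟨⟨p, hp⟩, hg⟩
    have : g⁻¹ = g := by
      rw [inv_eq_iff_mul_eq_one]
      ext1
      rcases hp with hp | hp <;> rw [Units.val_mul, hp] <;> simp [pauliOp_mul_self]
    rw [this]
    exact ⟨⟨p, hp⟩, hg⟩

lemma stabilizerSubgroup_le (h0 : ψ ≠ 0) (d : ℕ) :
    stabilizerSubgroup ψ d ≤ stabilizerGroup ψ h0 :=
  (Subgroup.closure_le _).2 fun _ ⟨⟨p, _, hp⟩, hg⟩ => ⟨⟨p, hp⟩, hg⟩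

lemma stabilizerSubgroup_self (h0 : ψ ≠ 0) :
    (stabilizerSubgroup ψ n : Set (QOp n)ˣ) = stabilizer ψ :=
  subset_antisymm (stabilizerSubgroup_le h0 n) fun _ ⟨⟨p, hp⟩, hg⟩ =>
    Subgroup.subset_closure ⟨⟨p, weight_le p, hp⟩, hg⟩

/-- The infimum is attained rather than a default value, because `d = n` qualifies. -/
lemma stabilizerSubgroup_eta (h0 : ψ ≠ 0) :
    (stabilizerSubgroup ψ (eta ψ) : Set (QOp n)ˣ) = stabilizer ψ :=
  Nat.sInf_mem (s := {d : ℕ | (stabilizerSubgroup ψ d : Set (QOp n)ˣ) = stabilizer ψ})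
    ⟨n, stabilizerSubgroup_self h0⟩

lemma conjTranspose_of_mem_stabilizer {g : (QOp n)ˣ} (hg : g ∈ stabilizer ψ) :
    (g : QOp n)ᴴ = g := by
  obtain ⟨⟨p, hp | hp⟩, -⟩ := hg <;>
    simp only [hp, Matrix.conjTranspose_neg, pauliOp_conjTranspose]

lemma finite_stabilizer (ψ : QVec n) : (stabilizer ψ).Finite := by
  have h : (Set.range (pauliOp (n := n)) ∪ Set.range fun p => -pauliOp (n := n) p).Finite :=
    (Set.finite_range _).union (Set.finite_range _)
  refine (h.preimage (f := fun g : (QOp n)ˣ => (g : QOp n)) Units.val_injective.injOn).subset ?_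
  rintro g ⟨⟨p, hp | hp⟩, -⟩
  · exact Or.inl ⟨p, hp.symm⟩
  · exact Or.inr ⟨p, hp.symm⟩

lemma QVec.eq_zero_of_neg_eq {φ : QVec n} (h : -φ = φ) : φ = 0 := by
  funext x
  have := congrFun h x
  simp only [Pi.neg_apply] at this
  exact self_eq_neg.1 this.symm

/-- Since `-1` does not fix `ψ`, some tensor factor of `g` is a traceless Pauli matrix. -/
lemma trace_eq_zero_of_mem_stabilizer (h0 : ψ ≠ 0) {g : (QOp n)ˣ} (hg : g ∈ stabilizer ψ)
    (h1 : g ≠ 1) : (g : QOp n).trace = 0 := by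
  obtain ⟨⟨p, hp⟩, hfix⟩ := hg
  have hpI : p ≠ fun _ => PauliLabel.I := by
    rintro rfl
    rw [pauliOp_I] at hp
    rcases hp with hp | hp
    · exact h1 (Units.ext hp)
    · rw [hp, Matrix.neg_mulVec, Matrix.one_mulVec] at hfix
      exact h0 (QVec.eq_zero_of_neg_eq hfix)
  rcases hp with hp | hp <;> simp [hp, trace_pauliOp hpI]

/-- Pauli operators with a common nonzero fixed vector, up to signs, commute. -/
lemma commSign_eq_one_of_mulVec_eq {φ : QVec n} (h0 : φ ≠ 0) {p q : PauliString n}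
    (hp : pauliOp p *ᵥ φ = φ ∨ pauliOp p *ᵥ φ = -φ) (hq : pauliOp q *ᵥ φ = φ) :
    commSign p q = 1 := by
  refine (commSign_eq_or p q).resolve_right fun h => h0 ?_
  have h1 := congrArg (· *ᵥ φ) (pauliOp_mul_comm p q)
  simp only [h, ← Matrix.mulVec_mulVec, hq, Matrix.smul_mulVec] at h1
  rcases hp with hp | hp
  · rw [hp, hq] at h1
    exact QVec.eq_zero_of_neg_eq (by simpa using h1.symm)
  · rw [hp, Matrix.mulVec_neg, hq] at h1
    exact QVec.eq_zero_of_neg_eq (by simpa using h1)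

end Stabilizer

/-! ### Uniqueness and Pauli expectations of the graph state. -/

section GraphState

variable {n : ℕ} {G : SimpleGraph (Fin n)} {ψ : QVec n}

lemma IsGraphState.ne_zero (hψ : IsGraphState G ψ) : ψ ≠ 0 := by
  rintro rfl
  simpa using hψ.1

lemma IsGraphState.star_dotProduct_self (hψ : IsGraphState G ψ) : star ψ ⬝ᵥ ψ = 1 := by
  have h : ((∑ x, ‖ψ x‖ ^ 2 : ℝ) : ℂ) = 1 := by rw [hψ.1, Complex.ofReal_one]
  rw [← h, Complex.ofReal_sum]
  refine Finset.sum_congr rfl fun x _ => ?_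
  simp [Complex.conj_mul']

lemma IsGraphState.pauliUnit_mem (hψ : IsGraphState G ψ) (a : Fin n) :
    pauliUnit (graphGenerator G a) ∈ stabilizer ψ :=
  ⟨⟨_, Or.inl rfl⟩, hψ.2 a⟩

/-- The generator at `a` flips the bit at `a`. -/
lemma pauliOp_graphGenerator_eq_zero {a : Fin n} {x y : Bits n}
    (h : y ≠ Function.update x a (1 - x a)) : pauliOp (graphGenerator G a) x y = 0 := by
  obtain ⟨b, hb⟩ := Function.ne_iff.1 h
  refine Finset.prod_eq_zero (Finset.mem_univ b) ?_
  have h1 : x b = 0 ∨ x b = 1 := by omega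
  have h2 : y b = 0 ∨ y b = 1 := by omega
  by_cases hba : b = a
  · subst hba
    rcases h1 with h1 | h1 <;> rcases h2 with h2 | h2 <;>
      simp [h1, h2] at hb <;> simp [graphGenerator, PauliLabel.toMatrix, h1, h2]
  · rw [Function.update_of_ne hba] at hb
    by_cases hA : G.Adj a b <;> rcases h1 with h1 | h1 <;> rcases h2 with h2 | h2 <;>
      simp [h1, h2] at hb <;> simp [graphGenerator, PauliLabel.toMatrix, h1, h2, hA, hba]

/-- A vector fixed by all generators is determined by its amplitude at `0`. -/
lemma eq_zero_of_apply_zero {φ : QVec n} (h : ∀ a, pauliOp (graphGenerator G a) *ᵥ φ = φ)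
    (h0 : φ 0 = 0) : φ = 0 := by
  -- Row `x` of the generator at `a` is supported on the single column where bit `a` is flipped.
  have hflip : ∀ a x, φ (Function.update x a (1 - x a)) = 0 → φ x = 0 := by
    intro a x hx
    rw [← h a]
    refine Finset.sum_eq_zero fun y _ => ?_
    by_cases hy : y = Function.update x a (1 - x a)
    · rw [hy, hx, mul_zero]
    · exact (congrArg (· * φ y) (pauliOp_graphGenerator_eq_zero hy)).trans (zero_mul _)
  have key : ∀ (s : Finset (Fin n)) (x : Bits n), (∀ i, i ∉ s → x i = 0) → φ x = 0 := by
    intro s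
    induction s using Finset.induction_on with
    | empty =>
      intro x hx
      rwa [show x = 0 from funext fun i => hx i (Finset.notMem_empty i)]
    | insert a s ha ih =>
      intro x hx
      have hxa : x a = 0 ∨ x a = 1 := by omega
      rcases hxa with hxa | hxa
      · refine ih x fun i hi => ?_
        by_cases hia : i = a
        · rw [hia, hxa]
        · exact hx i (by simp [hia, hi])
      · refine hflip a x (ih _ fun i hi => ?_)
        by_cases hia : i = a
        · subst hia; simp [hxa]
        · rw [Function.update_of_ne hia]
          exact hx i (by simp [hia, hi])
  funext x
  exact key Finset.univ x fun i hi => absurd (Finset.mem_univ i) hi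

/-- The graph state is unique up to a scalar. -/
lemma IsGraphState.exists_eq_smul (hψ : IsGraphState G ψ) {φ : QVec n}
    (h : ∀ a, pauliOp (graphGenerator G a) *ᵥ φ = φ) : ∃ c : ℂ, φ = c • ψ := by
  have hψ0 : ψ 0 ≠ 0 := fun h0 => hψ.ne_zero (eq_zero_of_apply_zero hψ.2 h0)
  -- The ratio makes the difference vanish at `0`, hence everywhere.
  refine ⟨φ 0 / ψ 0, sub_eq_zero.1 (eq_zero_of_apply_zero (G := G) (fun a => ?_) ?_)⟩
  · rw [Matrix.mulVec_sub, Matrix.mulVec_smul, h, hψ.2]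
  · simp [hψ0]

/-- The expectation of a Pauli operator in a graph state vanishes unless the operator is in the
stabilizer up to a sign. -/
lemma IsGraphState.expectation_eq_zero (hψ : IsGraphState G ψ) {p : PauliString n}
    (h1 : pauliOp p *ᵥ ψ ≠ ψ) (h2 : pauliOp p *ᵥ ψ ≠ -ψ) : star ψ ⬝ᵥ pauliOp p *ᵥ ψ = 0 := by
  by_cases hc : ∀ a, commSign (graphGenerator G a) p = 1
  · exfalso
    obtain ⟨c, hcψ⟩ := hψ.exists_eq_smul (φ := pauliOp p *ᵥ ψ) fun a => by
      rw [Matrix.mulVec_mulVec, pauliOp_mul_comm, hc, Int.cast_one, one_smul,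
        ← Matrix.mulVec_mulVec, hψ.2]
    have h3 : (c * c) • ψ = ψ := by
      conv_rhs => rw [← Matrix.one_mulVec ψ, ← pauliOp_mul_self p, ← Matrix.mulVec_mulVec, hcψ,
        Matrix.mulVec_smul, hcψ, smul_smul]
    have hcc : c * c = 1 := by
      have : (c * c - 1) • ψ = 0 := by rw [sub_smul, h3, one_smul, sub_self]
      exact sub_eq_zero.1 ((smul_eq_zero.1 this).resolve_right hψ.ne_zero)
    rcases mul_self_eq_one_iff.1 hcc with h | h
    · exact h1 (by rw [hcψ, h, one_smul])
    · exact h2 (by rw [hcψ, h, neg_one_smul])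
  · push Not at hc
    obtain ⟨a, ha⟩ := hc
    have ha := (commSign_eq_or (graphGenerator G a) p).resolve_left ha
    set K := pauliOp (graphGenerator G a) with hK
    have hKp : K * pauliOp p = -(pauliOp p * K) := by
      rw [hK, pauliOp_mul_comm, ha, Int.cast_neg, Int.cast_one, neg_one_smul]
    -- `K` is Hermitian and fixes `ψ`, so it can be inserted on the left and absorbed on the right,
    -- at the cost of a sign.
    have h3 : star ψ ⬝ᵥ pauliOp p *ᵥ ψ = -(star ψ ⬝ᵥ pauliOp p *ᵥ ψ) := by
      have hs : star ψ ᵥ* K = star ψ := by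
        conv_rhs => rw [← hψ.2 a, Matrix.star_mulVec, pauliOp_conjTranspose]
      conv_lhs => rw [← hs, ← Matrix.dotProduct_mulVec, Matrix.mulVec_mulVec, hKp,
        Matrix.neg_mulVec, ← Matrix.mulVec_mulVec, hψ.2, dotProduct_neg]
    exact self_eq_neg.1 h3

end GraphState

/-! ### Positive semidefinite operators and ground spaces. -/

section GroundState

open scoped ComplexOrder

variable {n : ℕ} {ψ : QVec n}

/-- Minimality over real eigenvalues suffices, since the shifted operator is Hermitian and its
spectrum is that of `H` shifted by `-E`. -/
lemma posSemidef_sub_groundEnergy {H : QOp n} (hH : H.IsHermitian) {E : ℝ}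
    (hE : ∀ μ : ℝ, Module.End.HasEigenvalue (Matrix.toLin' H) (μ : ℂ) → E ≤ μ) :
    (H - (E : ℂ) • 1).PosSemidef := by
  have hA : (H - (E : ℂ) • 1).IsHermitian := by
    refine hH.sub ?_
    rw [Matrix.IsHermitian, Matrix.conjTranspose_smul, Matrix.conjTranspose_one]
    simp
  rw [hA.posSemidef_iff_eigenvalues_nonneg]
  intro i
  have hv := hA.mulVec_eigenvectorBasis i
  set v : QVec n := ⇑(hA.eigenvectorBasis i) with hvdef
  have hv0 : v ≠ 0 := by
    intro h
    have h1 := hA.eigenvectorBasis.orthonormal.ne_zero i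
    exact h1 (by ext x; exact congrFun h x)
  have hle : E ≤ E + hA.eigenvalues i := by
    refine hE _ (Module.End.hasEigenvalue_of_hasEigenvector (x := v)
      ⟨Module.End.mem_eigenspace_iff.2 ?_, hv0⟩)
    rw [Matrix.sub_mulVec, Matrix.smul_mulVec, Matrix.one_mulVec, sub_eq_iff_eq_add] at hv
    rw [Matrix.toLin'_apply, hv, Complex.ofReal_add, add_smul, add_comm]
    rfl
  simpa using hle

lemma isNondegenerateGroundState_of_posSemidef {A : QOp n} (hA : A.PosSemidef) (E : ℝ)
    (h0 : ψ ≠ 0) (hψ : A *ᵥ ψ = 0) (hker : ∀ φ, A *ᵥ φ = 0 → ∃ c : ℂ, φ = c • ψ) :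
    IsNondegenerateGroundState (A + (E : ℂ) • 1) ψ := by
  have happ : ∀ φ, Matrix.toLin' (A + (E : ℂ) • 1) φ = A *ᵥ φ + (E : ℂ) • φ := fun φ => by
    rw [Matrix.toLin'_apply, Matrix.add_mulVec, Matrix.smul_mulVec, Matrix.one_mulVec]
  have hmem : ψ ∈ Module.End.eigenspace (Matrix.toLin' (A + (E : ℂ) • 1)) (E : ℂ) := by
    rw [Module.End.mem_eigenspace_iff, happ, hψ, zero_add]
  refine ⟨?_, E, ⟨hmem, h0⟩, fun μ hμ => ?_, ?_⟩
  · refine hA.1.add ?_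
    rw [Matrix.IsHermitian, Matrix.conjTranspose_smul, Matrix.conjTranspose_one]
    simp
  · obtain ⟨v, hv, hv0⟩ := hμ.exists_hasEigenvector
    rw [Module.End.mem_eigenspace_iff, happ] at hv
    have hAv : A *ᵥ v = ((μ - E : ℝ) : ℂ) • v := by
      rw [Complex.ofReal_sub, sub_smul, ← hv, add_sub_cancel_right]
    have h1 := hA.dotProduct_mulVec_nonneg v
    rw [hAv, dotProduct_smul, smul_eq_mul] at h1
    have h2 : 0 < star v ⬝ᵥ v := Matrix.dotProduct_star_self_pos_iff.2 hv0
    have h3 : (0 : ℂ) ≤ ((μ - E : ℝ) : ℂ) := le_of_mul_le_mul_right (by simpa using h1) h2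
    have := Complex.zero_le_real.1 h3
    linarith
  · refine (finrank_eq_one_iff_of_nonzero' ⟨ψ, hmem⟩ (by simpa using h0)).2 fun w => ?_
    obtain ⟨φ, hφ⟩ := w
    have hφ' := Module.End.mem_eigenspace_iff.1 hφ
    rw [happ, add_eq_right] at hφ'
    obtain ⟨c, hc⟩ := hker φ hφ'
    exact ⟨c, Subtype.ext hc.symm⟩

/-- For a Hermitian involution, `1 - g` is twice a projection, hence half its own square. -/
lemma posSemidef_one_sub {g : QOp n} (hg : gᴴ = g) (hgg : g * g = 1) : (1 - g).PosSemidef := by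
  have h : 1 - g = (1 / 2 : ℂ) • ((1 - g)ᴴ * (1 - g)) := by
    rw [Matrix.conjTranspose_sub, Matrix.conjTranspose_one, hg, sub_mul, mul_sub, mul_sub, hgg]
    simp only [one_mul, mul_one]
    module
  rw [h]
  have h2 : (0 : ℂ) ≤ 1 / 2 := by
    simp
  exact (Matrix.posSemidef_conjTranspose_mul_self _).smul h2

/-- The expectations in `φ` are nonnegative with sum zero, and a positive semidefinite operator
kills any vector of zero expectation. -/
lemma mulVec_eq_zero_of_sum {ι : Type*} {s : Finset ι} {A : ι → QOp n}
    (hA : ∀ i ∈ s, (A i).PosSemidef) {φ : QVec n} (h : (∑ i ∈ s, A i) *ᵥ φ = 0) {i : ι}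
    (hi : i ∈ s) : A i *ᵥ φ = 0 := by
  have h1 : ∑ i ∈ s, star φ ⬝ᵥ A i *ᵥ φ = 0 := by
    rw [← dotProduct_sum, ← Matrix.sum_mulVec, h, dotProduct_zero]
  exact ((hA i hi).dotProduct_mulVec_zero_iff φ).1
    ((Finset.sum_eq_zero_iff_of_nonneg fun j hj => (hA j hj).dotProduct_mulVec_nonneg φ).1 h1 i hi)

/-- If the expectation of a positive semidefinite operator in a multiple of a projection
vanishes, then so does their product. -/
lemma mul_eq_zero_of_trace_mul_eq_zero {A P : QOp n} (hA : A.PosSemidef) (hP : Pᴴ = P) {c : ℂ}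
    (hPP : P * P = c • P) (h : (A * P).trace = 0) : A * P = 0 := by
  -- This operator is positive semidefinite, and by cyclicity its trace is `c` times that of `A *
  -- P`.
  have h1 : Pᴴ * A * P = 0 := by
    refine (hA.conjTranspose_mul_mul_same P).trace_eq_zero_iff.1 ?_
    rw [hP, mul_assoc, Matrix.trace_mul_comm, mul_assoc, hPP, Matrix.mul_smul, Matrix.trace_smul, h,
      smul_zero]
  refine Matrix.ext_of_mulVec_single fun x => ?_
  rw [← Matrix.mulVec_mulVec, Matrix.zero_mulVec, ← hA.dotProduct_mulVec_zero_iff,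
    Matrix.star_mulVec, ← Matrix.dotProduct_mulVec, Matrix.mulVec_mulVec, Matrix.mulVec_mulVec,
    h1, Matrix.zero_mulVec, dotProduct_zero]

end GroundState

/-! ### Upper bound: the parent Hamiltonian. -/

section ParentHamiltonian

variable {n : ℕ} {G : SimpleGraph (Fin n)} {ψ : QVec n}

/-- A vector fixed by the stabilizer elements of weight at most `d` is fixed by the group they
generate. -/
lemma mulVec_eq_of_mem_stabilizerSubgroup {φ : QVec n} {d : ℕ}
    (h : ∀ g ∈ stabilizerUpTo ψ d, (g : QOp n) *ᵥ φ = φ) {g : (QOp n)ˣ}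
    (hg : g ∈ stabilizerSubgroup ψ d) : (g : QOp n) *ᵥ φ = φ := by
  induction hg using Subgroup.closure_induction with
  | mem g hg => exact h g hg
  | one => simp
  | mul g k _ _ hg hk => rw [Units.val_mul, ← Matrix.mulVec_mulVec, hk, hg]
  | inv g _ hg =>
    conv_lhs => rw [← hg, Matrix.mulVec_mulVec, Units.inv_mul, Matrix.one_mulVec]

open Classical in
/-- The eigenvalue of `ψ` under a Pauli operator, or `0` if there is none. -/
noncomputable def pauliSign (ψ : QVec n) (p : PauliString n) : ℝ :=
  if pauliOp p *ᵥ ψ = ψ then 1 else if pauliOp p *ᵥ ψ = -ψ then -1 else 0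

lemma pauliSign_of_eq {p : PauliString n} (h : pauliOp p *ᵥ ψ = ψ) : pauliSign ψ p = 1 :=
  if_pos h

lemma pauliSign_of_eq_neg (h0 : ψ ≠ 0) {p : PauliString n} (h : pauliOp p *ᵥ ψ = -ψ) :
    pauliSign ψ p = -1 := by
  rw [pauliSign, if_neg fun h' => h0 (QVec.eq_zero_of_neg_eq (h.symm.trans h')), if_pos h]

/-- A stabilizer element contributes the projection `1 - g` to the parent Hamiltonian. -/
noncomputable def parentTerm (ψ : QVec n) (p : PauliString n) : QOp n :=
  ((|pauliSign ψ p| : ℝ) : ℂ) • 1 - (pauliSign ψ p : ℂ) • pauliOp p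

lemma parentTerm_cases (ψ : QVec n) (p : PauliString n) :
    (pauliOp p *ᵥ ψ = ψ ∧ parentTerm ψ p = 1 - pauliOp p) ∨
    (pauliOp p *ᵥ ψ = -ψ ∧ parentTerm ψ p = 1 - -pauliOp p) ∨ parentTerm ψ p = 0 := by
  by_cases h1 : pauliOp p *ᵥ ψ = ψ
  · exact Or.inl ⟨h1, by simp [parentTerm, pauliSign, h1]⟩
  · by_cases h2 : pauliOp p *ᵥ ψ = -ψ
    · exact Or.inr (Or.inl ⟨h2, by simp only [parentTerm, pauliSign, if_neg h1, if_pos h2]; simp⟩)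
    · exact Or.inr (Or.inr (by simp [parentTerm, pauliSign, h1, h2]))

open scoped ComplexOrder in
lemma posSemidef_parentTerm (ψ : QVec n) (p : PauliString n) : (parentTerm ψ p).PosSemidef := by
  rcases parentTerm_cases ψ p with ⟨-, h⟩ | ⟨-, h⟩ | h <;> rw [h]
  · exact posSemidef_one_sub (pauliOp_conjTranspose p) (pauliOp_mul_self p)
  · exact posSemidef_one_sub (by rw [Matrix.conjTranspose_neg, pauliOp_conjTranspose])
      (by rw [neg_mul_neg, pauliOp_mul_self])
  · exact Matrix.PosSemidef.zero

lemma parentTerm_mulVec (ψ : QVec n) (p : PauliString n) : parentTerm ψ p *ᵥ ψ = 0 := by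
  rcases parentTerm_cases ψ p with ⟨h', h⟩ | ⟨h', h⟩ | h <;> rw [h]
  · rw [Matrix.sub_mulVec, h', Matrix.one_mulVec, sub_self]
  · rw [Matrix.sub_mulVec, Matrix.neg_mulVec, h', Matrix.one_mulVec, neg_neg, sub_self]
  · rw [Matrix.zero_mulVec]

open scoped ComplexOrder in
/-- A graph state is the non-degenerate ground state of an `η`-body Hamiltonian. -/
theorem IsGraphState.exists_parentHamiltonian (hψ : IsGraphState G ψ) :
    ∃ H : QOp n, IsBodyHamiltonian (eta ψ) H ∧ IsNondegenerateGroundState H ψ := by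
  set F := Finset.univ.filter (fun p : PauliString n => weight p ≤ eta ψ) with hF
  -- This shift cancels the identity parts of the terms, leaving `-∑ pauliSign ψ p • pauliOp p`.
  set E : ℝ := -∑ p ∈ F, |pauliSign ψ p| with hE
  refine ⟨∑ p ∈ F, parentTerm ψ p + (E : ℂ) • 1, ⟨fun p => -pauliSign ψ p, ?_⟩, ?_⟩
  · simp only [parentTerm, Finset.sum_sub_distrib, ← Finset.sum_smul, hE, Complex.ofReal_neg,
      Complex.ofReal_sum, neg_smul, Finset.sum_neg_distrib]
    abel
  · refine isNondegenerateGroundState_of_posSemidef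
      (Matrix.posSemidef_sum _ fun p _ => posSemidef_parentTerm ψ p) E hψ.ne_zero ?_ ?_
    · rw [Matrix.sum_mulVec]
      exact Finset.sum_eq_zero fun p _ => parentTerm_mulVec ψ p
    · intro φ hφ
      have hterm : ∀ p ∈ F, parentTerm ψ p *ᵥ φ = 0 := fun p hp =>
        mulVec_eq_zero_of_sum (fun p _ => posSemidef_parentTerm ψ p) hφ hp
      have hup : ∀ g ∈ stabilizerUpTo ψ (eta ψ), (g : QOp n) *ᵥ φ = φ := by
        rintro g ⟨⟨p, hpw, hp⟩, hg⟩
        have ht := hterm p (by simpa [hF] using hpw)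
        rcases hp with hp | hp <;> rw [hp] at hg ⊢
        · simp only [parentTerm, pauliSign_of_eq hg, Matrix.sub_mulVec,
            Matrix.one_mulVec, abs_one, Complex.ofReal_one, one_smul] at ht
          exact (sub_eq_zero.1 ht).symm
        · have hg' : pauliOp p *ᵥ ψ = -ψ := by
            rw [← hg, Matrix.neg_mulVec, neg_neg, ← Matrix.neg_mulVec, hg]
          simp only [parentTerm, pauliSign_of_eq_neg hψ.ne_zero hg', Matrix.sub_mulVec,
            Matrix.one_mulVec, abs_neg, abs_one, Complex.ofReal_one,
            Complex.ofReal_neg, one_smul, neg_smul] at ht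
          exact (sub_eq_zero.1 ht).symm
      refine hψ.exists_eq_smul fun a => ?_
      have hmem : pauliUnit (graphGenerator G a) ∈
          (stabilizerSubgroup ψ (eta ψ) : Set (QOp n)ˣ) := by
        rw [stabilizerSubgroup_eta hψ.ne_zero]
        exact hψ.pauliUnit_mem a
      exact mulVec_eq_of_mem_stabilizerSubgroup hup hmem

end ParentHamiltonian

/-! ### Lower bound: averaging over `S_d`. -/

section LowerBound

variable {n : ℕ} {G : SimpleGraph (Fin n)} {ψ : QVec n}

/-- The sum of the elements of `S_d`. -/
noncomputable def stabilizerSum (ψ : QVec n) (d : ℕ) : QOp n :=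
  ∑ᶠ g ∈ (stabilizerSubgroup ψ d : Set (QOp n)ˣ), (g : QOp n)

lemma stabilizerSum_eq (h0 : ψ ≠ 0) (d : ℕ) [Fintype (stabilizerSubgroup ψ d)] :
    stabilizerSum ψ d = ∑ g : stabilizerSubgroup ψ d, ((g : (QOp n)ˣ) : QOp n) := by
  rw [stabilizerSum, finsum_mem_eq_finite_toFinset_sum _
    ((finite_stabilizer ψ).subset (stabilizerSubgroup_le h0 d))]
  exact Finset.sum_subtype _ (fun x => by simp) _

lemma exists_fintype_stabilizerSubgroup (h0 : ψ ≠ 0) (d : ℕ) :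
    Nonempty (Fintype (stabilizerSubgroup ψ d)) :=
  ⟨((finite_stabilizer ψ).subset (stabilizerSubgroup_le h0 d)).fintype⟩

/-- Left translation permutes the group. -/
lemma mul_stabilizerSum (h0 : ψ ≠ 0) {d : ℕ} {g : (QOp n)ˣ} (hg : g ∈ stabilizerSubgroup ψ d) :
    (g : QOp n) * stabilizerSum ψ d = stabilizerSum ψ d := by
  obtain ⟨_⟩ := exists_fintype_stabilizerSubgroup h0 d
  rw [stabilizerSum_eq h0, Finset.mul_sum]
  exact Fintype.sum_equiv (Equiv.mulLeft ⟨g, hg⟩) _ _ fun x => by simp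

lemma stabilizerSum_mul_self (h0 : ψ ≠ 0) (d : ℕ) :
    ∃ c : ℂ, stabilizerSum ψ d * stabilizerSum ψ d = c • stabilizerSum ψ d := by
  obtain ⟨_⟩ := exists_fintype_stabilizerSubgroup h0 d
  refine ⟨(Fintype.card (stabilizerSubgroup ψ d) : ℂ), ?_⟩
  conv_lhs => rw [stabilizerSum_eq h0, Finset.sum_mul, ← stabilizerSum_eq h0]
  rw [Finset.sum_congr rfl fun g _ => mul_stabilizerSum h0 g.2, Finset.sum_const, Finset.card_univ,
    Nat.cast_smul_eq_nsmul]

lemma conjTranspose_stabilizerSum (h0 : ψ ≠ 0) (d : ℕ) :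
    (stabilizerSum ψ d)ᴴ = stabilizerSum ψ d := by
  obtain ⟨_⟩ := exists_fintype_stabilizerSubgroup h0 d
  rw [stabilizerSum_eq h0, Matrix.conjTranspose_sum]
  exact Finset.sum_congr rfl fun g _ =>
    conjTranspose_of_mem_stabilizer (stabilizerSubgroup_le h0 d g.2)

lemma trace_mul_stabilizerSum_of_notMem (h0 : ψ ≠ 0) {d : ℕ} {s : (QOp n)ˣ}
    (hs : s ∈ stabilizer ψ) (hsd : s ∉ stabilizerSubgroup ψ d) :
    ((s : QOp n) * stabilizerSum ψ d).trace = 0 := by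
  obtain ⟨_⟩ := exists_fintype_stabilizerSubgroup h0 d
  rw [stabilizerSum_eq h0, Finset.mul_sum, Matrix.trace_sum]
  refine Finset.sum_eq_zero fun g _ => ?_
  rw [← Units.val_mul]
  refine trace_eq_zero_of_mem_stabilizer h0
    ((stabilizerGroup ψ h0).mul_mem hs (stabilizerSubgroup_le h0 d g.2)) fun h => hsd ?_
  rw [mul_eq_one_iff_eq_inv.1 h]
  exact inv_mem g.2

/-- Only the identity has nonzero trace. -/
lemma trace_stabilizerSum (h0 : ψ ≠ 0) (d : ℕ) : (stabilizerSum ψ d).trace = 2 ^ n := by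
  obtain ⟨_⟩ := exists_fintype_stabilizerSubgroup h0 d
  rw [stabilizerSum_eq h0, Matrix.trace_sum, Finset.sum_eq_single 1, ← trace_one_qOp]
  · simp
  · intro g _ hg
    exact trace_eq_zero_of_mem_stabilizer h0 (stabilizerSubgroup_le h0 d g.2)
      fun h => hg (Subtype.ext h)
  · simp

/-- Up to normalization, the sum over `S_d` has the same expectations of Pauli operators of weight
at most `d` as the graph state. -/
lemma IsGraphState.trace_pauliOp_mul_stabilizerSum (hψ : IsGraphState G ψ) {d : ℕ}
    {p : PauliString n} (hp : weight p ≤ d) :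
    (pauliOp p * stabilizerSum ψ d).trace = 2 ^ n * (star ψ ⬝ᵥ pauliOp p *ᵥ ψ) := by
  have h0 := hψ.ne_zero
  by_cases h1 : pauliOp p *ᵥ ψ = ψ
  · have hmem : pauliUnit p ∈ stabilizerSubgroup ψ d :=
      Subgroup.subset_closure ⟨⟨p, hp, Or.inl rfl⟩, h1⟩
    rw [h1, hψ.star_dotProduct_self, ← val_pauliUnit, mul_stabilizerSum h0 hmem,
      trace_stabilizerSum h0, mul_one]
  by_cases h2 : pauliOp p *ᵥ ψ = -ψ
  · have hmem : -pauliUnit p ∈ stabilizerSubgroup ψ d := by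
      refine Subgroup.subset_closure ⟨⟨p, hp, Or.inr rfl⟩, ?_⟩
      rw [Units.val_neg, val_pauliUnit, Matrix.neg_mulVec, h2, neg_neg]
    have h3 := congrArg Matrix.trace (mul_stabilizerSum h0 hmem)
    rw [Units.val_neg, val_pauliUnit, neg_mul, Matrix.trace_neg, trace_stabilizerSum h0] at h3
    rw [h2, dotProduct_neg, hψ.star_dotProduct_self]
    linear_combination -h3
  -- Neither sign of `pauliOp p` is in the stabilizer, so it is trace-orthogonal to every summand.
  · rw [hψ.expectation_eq_zero h1 h2, mul_zero]
    obtain ⟨_⟩ := exists_fintype_stabilizerSubgroup h0 d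
    rw [stabilizerSum_eq h0, Finset.mul_sum, Matrix.trace_sum]
    refine Finset.sum_eq_zero fun g _ => ?_
    obtain ⟨⟨q, hq⟩, hg⟩ := stabilizerSubgroup_le h0 d g.2
    have hpq : p ≠ q := by
      rintro rfl
      rcases hq with hq | hq <;> rw [hq] at hg
      · exact h1 hg
      · exact h2 (by rw [← hg, Matrix.neg_mulVec, neg_neg, ← Matrix.neg_mulVec, hg])
    rcases hq with hq | hq <;> simp [hq, trace_pauliOp_mul hpq]

/-- A Hamiltonian with a graph state as non-degenerate ground state involves at least `η`-body
interactions. -/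
theorem IsGraphState.eta_le (hψ : IsGraphState G ψ) {d : ℕ} {H : QOp n}
    (hd : IsBodyHamiltonian d H) (hH : IsNondegenerateGroundState H ψ) : eta ψ ≤ d := by
  have h0 := hψ.ne_zero
  obtain ⟨h, rfl⟩ := hd
  set F := Finset.univ.filter (fun p : PauliString n => weight p ≤ d) with hF
  set H : QOp n := ∑ p ∈ F, (h p : ℂ) • pauliOp p with hHdef
  obtain ⟨hherm, E, ⟨hE, -⟩, hmin, hrank⟩ := hH
  set P := stabilizerSum ψ d with hP
  have hHψ : H *ᵥ ψ = (E : ℂ) • ψ := Module.End.mem_eigenspace_iff.1 hE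
  have htr : (H * P).trace = 2 ^ n * (E : ℂ) := by
    have h1 : star ψ ⬝ᵥ H *ᵥ ψ = E := by
      rw [hHψ, dotProduct_smul, hψ.star_dotProduct_self, smul_eq_mul, mul_one]
    rw [← h1, hHdef, Finset.sum_mul, Matrix.trace_sum, Matrix.sum_mulVec, dotProduct_sum,
      Finset.mul_sum]
    refine Finset.sum_congr rfl fun p hp => ?_
    rw [Matrix.smul_mul, Matrix.trace_smul, Matrix.smul_mulVec, dotProduct_smul,
      hψ.trace_pauliOp_mul_stabilizerSum (by simpa [hF] using hp), smul_eq_mul, smul_eq_mul]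
    ring
  obtain ⟨c, hc⟩ := stabilizerSum_mul_self h0 d
  have hAP : (H - (E : ℂ) • 1) * P = 0 := by
    refine mul_eq_zero_of_trace_mul_eq_zero (posSemidef_sub_groundEnergy hherm hmin)
      (conjTranspose_stabilizerSum h0 d) hc ?_
    rw [sub_mul, Matrix.trace_sub, htr, Matrix.smul_mul, one_mul, Matrix.trace_smul,
      trace_stabilizerSum h0, smul_eq_mul]
    ring
  -- The range of `P` lies in the ground space, which is one-dimensional.
  have hcol : ∀ v, ∃ a : ℂ, P *ᵥ v = a • ψ := by
    intro v
    have hv : P *ᵥ v ∈ Module.End.eigenspace (Matrix.toLin' H) (E : ℂ) := by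
      rw [Module.End.mem_eigenspace_iff, Matrix.toLin'_apply]
      have := congrArg (· *ᵥ v) hAP
      simp only [← Matrix.mulVec_mulVec, Matrix.sub_mulVec, Matrix.smul_mulVec, Matrix.one_mulVec,
        Matrix.zero_mulVec] at this
      exact sub_eq_zero.1 this
    obtain ⟨a, ha⟩ := (finrank_eq_one_iff_of_nonzero'
      (⟨ψ, hE⟩ : Module.End.eigenspace (Matrix.toLin' H) (E : ℂ)) (by simpa using h0)).1 hrank
      ⟨_, hv⟩
    exact ⟨a, (congrArg Subtype.val ha).symm⟩
  refine Nat.sInf_le (subset_antisymm (stabilizerSubgroup_le h0 d) fun s hs => ?_)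
  by_contra hsd
  have hsP : (s : QOp n) * P = P := by
    refine Matrix.ext_of_mulVec_single fun x => ?_
    obtain ⟨a, ha⟩ := hcol (Pi.single x 1)
    rw [← Matrix.mulVec_mulVec, ha, Matrix.mulVec_smul, hs.2]
  have h1 := trace_mul_stabilizerSum_of_notMem h0 hs hsd
  rw [hsP, trace_stabilizerSum h0] at h1
  exact pow_ne_zero n two_ne_zero h1

end LowerBound

/-! ### Connected graphs: weight two does not generate. -/

section ConnectedGraphs

variable {n : ℕ} {G : SimpleGraph (Fin n)} {ψ : QVec n}

/-- A vertex with at least two neighbours. -/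
def IsBranching (G : SimpleGraph (Fin n)) (v : Fin n) : Prop :=
  ∃ c d, c ≠ d ∧ G.Adj v c ∧ G.Adj v d

/-- A connected graph on at least three vertices has an edge leaving any pair of vertices. -/
lemma exists_adj_of_pair (hG : G.Connected) (hn : 3 ≤ n) (a b : Fin n) :
    ∃ c, c ≠ a ∧ c ≠ b ∧ (G.Adj c a ∨ G.Adj c b) := by
  obtain ⟨v, hv⟩ : ∃ v, v ∉ ({a, b} : Finset (Fin n)) := by
    by_contra! h
    have h1 := Finset.card_le_card (show Finset.univ ⊆ ({a, b} : Finset (Fin n)) from fun x _ => h x)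
    have h2 := Finset.card_le_two (a := a) (b := b)
    rw [Finset.card_univ, Fintype.card_fin] at h1
    omega
  obtain ⟨w⟩ := hG.preconnected a v
  obtain ⟨e, -, h1, h2⟩ := w.exists_boundary_dart {a, b} (by simp) (by simpa using hv)
  simp only [Set.mem_insert_iff, Set.mem_singleton_iff, not_or] at h1 h2
  have he := e.adj.symm
  rcases h1 with h1 | h1 <;> rw [h1] at he
  · exact ⟨_, h2.1, h2.2, Or.inl he⟩
  · exact ⟨_, h2.1, h2.2, Or.inr he⟩

/-- The degenerate pair `(0, 0)` yields an edge from `0` to some `b`; a third vertex then attaches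
to `0` or `b`, giving that endpoint a second neighbour. -/
lemma exists_isBranching (hG : G.Connected) (hn : 3 ≤ n) : ∃ v, IsBranching G v := by
  obtain ⟨b, hb, -, hab⟩ := exists_adj_of_pair hG hn ⟨0, by omega⟩ ⟨0, by omega⟩
  obtain ⟨c, hca, hcb, h⟩ := exists_adj_of_pair hG hn ⟨0, by omega⟩ b
  rw [or_self] at hab
  rcases h with h | h
  · exact ⟨_, b, c, hcb.symm, hab.symm, h.symm⟩
  · exact ⟨b, _, c, hca.symm, hab, h.symm⟩

/-- If every vertex outside `{a, b}` is adjacent to both or neither of `a` and `b`, then `a` and `b`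
are both branching or both not. -/
lemma IsBranching.of_twin (hG : G.Connected) (hn : 3 ≤ n) {a b : Fin n}
    (h : ∀ c, c ≠ a → c ≠ b → (G.Adj c a ↔ G.Adj c b)) (ha : IsBranching G a) :
    IsBranching G b := by
  -- If `a` and `b` are adjacent, a third vertex attached to either is a second neighbour of `b`;
  -- otherwise every neighbour of `a` is one of `b`.
  by_cases hadj : G.Adj a b
  · obtain ⟨c, hca, hcb, hc⟩ := exists_adj_of_pair hG hn a b
    have hc' : G.Adj c b := hc.elim (h c hca hcb).1 id
    exact ⟨a, c, hca.symm, hadj.symm, hc'.symm⟩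
  · obtain ⟨c, d, hcd, hc, hd⟩ := ha
    have key : ∀ e, G.Adj a e → G.Adj b e := fun e he =>
      ((h e he.ne' (by rintro rfl; exact hadj he)).1 he.symm).symm
    exact ⟨c, d, hcd, key c hc, key d hd⟩

lemma PauliLabel.commSign_Z (p : PauliLabel) :
    p.commSign .Z = if p = .X ∨ p = .Y then -1 else 1 := by
  cases p <;> simp [commSign]

lemma commSign_eq_mul {p q : PauliString n} {a b : Fin n} (hab : a ≠ b)
    (hp : ∀ i, i ≠ a → i ≠ b → p i = PauliLabel.I) :
    commSign p q = (p a).commSign (q a) * (p b).commSign (q b) :=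
  Fintype.prod_eq_mul a b hab fun i hi => by simp [hp i hi.1 hi.2, PauliLabel.commSign]

/-- Padding the support to exactly two qubits avoids separate cases for weights `0` and `1`. -/
lemma exists_pair_of_weight_le_two {p : PauliString n} (hn : 3 ≤ n) (hp : weight p ≤ 2) :
    ∃ a b, a ≠ b ∧ ∀ i, i ≠ a → i ≠ b → p i = PauliLabel.I := by
  obtain ⟨t, hst, -, ht⟩ := Finset.exists_subsuperset_card_eq
    (Finset.subset_univ (Finset.univ.filter fun i => p i ≠ PauliLabel.I)) hp
    (by rw [Finset.card_univ, Fintype.card_fin]; omega)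
  obtain ⟨a, b, hab, rfl⟩ := Finset.card_eq_two.1 ht
  refine ⟨a, b, hab, fun i hia hib => ?_⟩
  by_contra hi
  have := hst (by simpa using hi)
  simp [hia, hib] at this

open Classical in
/-- The Pauli string with `Z` on the branching vertices. -/
noncomputable def branchingZ (G : SimpleGraph (Fin n)) : PauliString n :=
  fun v => if IsBranching G v then PauliLabel.Z else PauliLabel.I

/-- In a connected graph on at least three vertices, the stabilizer elements of weight at most two
commute with `branchingZ G`. -/
lemma IsGraphState.commSign_branchingZ (hψ : IsGraphState G ψ) (hG : G.Connected) (hn : 3 ≤ n)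
    {p : PauliString n} (hw : weight p ≤ 2)
    (hp : pauliOp p *ᵥ ψ = ψ ∨ pauliOp p *ᵥ ψ = -ψ) : commSign p (branchingZ G) = 1 := by
  classical
  obtain ⟨a, b, hab, hI⟩ := exists_pair_of_weight_le_two hn hw
  -- The generator at `c` acts on `a` and `b` only by `Z` or `I`, so commuting with it constrains
  -- the adjacency of `c` to those where `p` has `X` or `Y`.
  have hgen : ∀ c, c ≠ a → c ≠ b →
      (if G.Adj c a then (p a).commSign .Z else 1) *
        (if G.Adj c b then (p b).commSign .Z else 1) = 1 := by
    intro c hca hcb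
    have h := commSign_eq_one_of_mulVec_eq hψ.ne_zero hp (hψ.2 c)
    rw [commSign_eq_mul hab hI] at h
    have hval : ∀ i, c ≠ i → (p i).commSign (graphGenerator G c i) =
        if G.Adj c i then (p i).commSign .Z else 1 := by
      intro i hi
      by_cases hA : G.Adj c i <;> simp [graphGenerator, hi.symm, hA, PauliLabel.commSign]
    rwa [hval a hca, hval b hcb] at h
  have hZ : ∀ i, (p i).commSign (branchingZ G i) =
      if IsBranching G i then (p i).commSign .Z else 1 := by
    intro i
    by_cases hA : IsBranching G i <;> simp [branchingZ, hA, PauliLabel.commSign]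
  have hleaf : ∀ {i j : Fin n}, (∀ c, c ≠ i → c ≠ j → ¬ G.Adj c i) → ¬ IsBranching G i := by
    rintro i j h ⟨c, d, hcd, hc, hd⟩
    have key : ∀ e, G.Adj i e → e = j := fun e he => by
      by_contra hej
      exact h e he.ne' hej he.symm
    exact hcd ((key c hc).trans (key d hd).symm)
  rw [commSign_eq_mul hab hI, hZ, hZ]
  simp only [PauliLabel.commSign_Z] at hgen ⊢
  by_cases ha : p a = .X ∨ p a = .Y <;> by_cases hb : p b = .X ∨ p b = .Y <;>
    simp only [ha, hb, if_true, if_false, ite_self, mul_one, one_mul] at hgen ⊢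
  -- With `X` or `Y` on both qubits, the signs at each `c` must cancel, so `a` and `b` are twins.
  · have htwin : ∀ c, c ≠ a → c ≠ b → (G.Adj c a ↔ G.Adj c b) := by
      intro c hca hcb
      have := hgen c hca hcb
      by_cases h1 : G.Adj c a <;> by_cases h2 : G.Adj c b <;> simp [h1, h2] at this ⊢
    have hiff : IsBranching G a ↔ IsBranching G b :=
      ⟨fun h => h.of_twin hG hn htwin,
        fun h => h.of_twin hG hn fun c hcb hca => (htwin c hca hcb).symm⟩
    by_cases h : IsBranching G b <;> simp [hiff, h]
  -- With `X` or `Y` on `a` alone, no `c` outside the pair can be adjacent to `a`, so `a` has at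
  -- most the neighbour `b`.
  · rw [if_neg (hleaf (j := b) fun c hca hcb h => ?_)]
    have := hgen c hca hcb
    simp [h] at this
  · rw [if_neg (hleaf (j := a) fun c hcb hca h => ?_)]
    have := hgen c hca hcb
    simp [h] at this

/-- The generator at a branching vertex anticommutes with `branchingZ G`. -/
lemma commSign_graphGenerator_branchingZ {v : Fin n} (hv : IsBranching G v) :
    commSign (graphGenerator G v) (branchingZ G) = -1 := by
  rw [commSign, Fintype.prod_eq_single v]
  · simp [graphGenerator, branchingZ, hv, PauliLabel.commSign]
  · intro i hi
    by_cases h1 : G.Adj v i <;> by_cases h2 : IsBranching G i <;>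
      simp [graphGenerator, branchingZ, hi, h1, h2, PauliLabel.commSign]

/-- If `η ≤ 2`, the whole stabilizer would centralize `branchingZ G`, but the generator at a
branching vertex does not. -/
theorem IsGraphState.three_le_eta (hψ : IsGraphState G ψ) (hG : G.Connected) (hn : 3 ≤ n) :
    3 ≤ eta ψ := by
  by_contra! hlt
  obtain ⟨v, hv⟩ := exists_isBranching hG hn
  set D := pauliOp (branchingZ G) with hD
  have hcomm : stabilizerSubgroup ψ (eta ψ) ≤ Subgroup.centralizer {pauliUnit (branchingZ G)} := by
    refine (Subgroup.closure_le _).2 ?_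
    rintro g ⟨⟨p, hw, hp⟩, hg⟩
    rw [SetLike.mem_coe, Subgroup.mem_centralizer_singleton_iff]
    have hpψ : pauliOp p *ᵥ ψ = ψ ∨ pauliOp p *ᵥ ψ = -ψ := by
      rcases hp with hp | hp <;> rw [hp] at hg
      · exact Or.inl hg
      · right; rw [← hg, Matrix.neg_mulVec, neg_neg, ← Matrix.neg_mulVec, hg]
    have h1 : pauliOp p * D = D * pauliOp p := by
      rw [hD, pauliOp_mul_comm, hψ.commSign_branchingZ hG hn (by omega) hpψ, Int.cast_one, one_smul]
    ext1
    rw [Units.val_mul, Units.val_mul, val_pauliUnit]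
    rcases hp with hp | hp <;> rw [hp]
    · exact h1
    · rw [neg_mul, mul_neg, h1]
  have hmem : pauliUnit (graphGenerator G v) ∈ stabilizerSubgroup ψ (eta ψ) := by
    have h := hψ.pauliUnit_mem v
    rwa [← stabilizerSubgroup_eta hψ.ne_zero] at h
  have h1 := congrArg Units.val (Subgroup.mem_centralizer_singleton_iff.1 (hcomm hmem))
  rw [Units.val_mul, Units.val_mul, val_pauliUnit, val_pauliUnit, pauliOp_mul_comm,
    commSign_graphGenerator_branchingZ hv, Int.cast_neg, Int.cast_one, neg_one_smul] at h1
  -- Multiplying by the two involutions undoes both factors and leaves `-ψ = ψ`.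
  have h2 := congrArg (fun M => (pauliOp (graphGenerator G v) * (D * M)) *ᵥ ψ) h1
  simp only [mul_neg, Matrix.neg_mulVec] at h2
  rw [← mul_assoc D, pauliOp_mul_self, one_mul, pauliOp_mul_self, Matrix.one_mulVec] at h2
  exact hψ.ne_zero (QVec.eq_zero_of_neg_eq h2)

end ConnectedGraphs

theorem theorem3 {n : ℕ} (G : SimpleGraph (Fin n)) (ψ : QVec n) (hψ : IsGraphState G ψ) :
    (∃ H : QOp n, IsBodyHamiltonian (eta ψ) H ∧ IsNondegenerateGroundState H ψ) ∧
    (∀ (d : ℕ) (H : QOp n), IsBodyHamiltonian d H → IsNondegenerateGroundState H ψ →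
      eta ψ ≤ d) ∧
    (G.Connected → 3 ≤ n →
      3 ≤ eta ψ ∧
      ∀ H : QOp n, IsBodyHamiltonian 2 H → ¬ IsNondegenerateGroundState H ψ) := by
  refine ⟨hψ.exists_parentHamiltonian, fun d H => hψ.eta_le, fun hG hn => ?_⟩
  have h3 := hψ.three_le_eta hG hn
  refine ⟨h3, fun H hH hg => ?_⟩
  have := hψ.eta_le hH hg
  omega
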